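/- Let $\mathbb{K}\in\{\mathbb{R},\mathbb{C}\}$ and let $n\in\mathbb{N}$. A polynomial $f\in\mathbb{K}[z_1,\dots,z_n]$ is called stable (real stable if $\mathbb{K}=\mathbb{R}$) if $f(z)\neq 0$ for all $z\in\mathbb{C}^n$ with $\operatorname{Im} z_j>0$ for $1\le j\le n$. The symbol of a finite order linear differential operator $T=\sum_{\alpha,\beta}a_{\alpha\beta}z^\alpha\partial^\beta$ on $\mathbb{K}[z_1,\dots,z_n]$ (a finite sum, $\alpha,\beta\in\mathbb{N}^n$, $a_{\alpha\beta}\in\mathbb{K}$) is the polynomial $F(z,w)=\sum_{\alpha,\beta}a_{\alpha\beta}z^\alpha w^\beta$ in $\mathbb{K}[z_1,\dots,z_n,w_1,\dots,w_n]$. Let $\mathcal{A}_n(\mathbb{K})$ be the set of all nonzero operators $T$ of this form such that for every stable $f\in\mathbb{K}[z_1,\dots,z_n]$ the polynomial $T(f)$ is stable or identically zero; the elements of $\mathcal{A}_n(\mathbb{R})$ are the real stability preservers and those of $\mathcal{A}_n(\mathbb{C})$ the (complex) stability preservers. **Theorem.** If $F(z,w)\in\mathbb{R}[z_1,\dots,z_n,w_1,\dots,w_n]$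 is the symbol of an operator in $\mathcal{A}_n(\mathbb{R})$, then for every $(\mu,\lambda)\in[0,1]^n\times[0,1]^n$ the polynomial $F(\mu z,\lambda w)=F(\mu_1z_1,\dots,\mu_nz_n,\lambda_1w_1,\dots,\lambda_nw_n)$ is again the symbol of an operator in $\mathcal{A}_n(\mathbb{R})$, unless it is identically zero, which can happen only if some $\mu_i$ or some $\lambda_i$ is $0$. The corresponding statement holds for $F\in\mathbb{C}[z_1,\dots,z_n,w_1,\dots,w_n]$ and $\mathcal{A}_n(\mathbb{C})$ (still with real $(\mu,\lambda)\in[0,1]^n\times[0,1]^n$). -/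

import Mathlib

noncomputable section

namespace WeylStab

open MvPolynomial

/-- Stability of a polynomial in `n` variables over a coefficient field `K` with a map to `ℂ`
(used for `K = ℂ`: stable, and `K = ℝ`: real stable): it has no zero all of whose coordinates
have positive imaginary part. -/
def IsStable {K : Type*} [Field K] [Algebra K ℂ] {n : ℕ} (f : MvPolynomial (Fin n) K) : Prop :=
  ∀ z : Fin n → ℂ, (∀ i, 0 < (z i).im) → aeval z f ≠ 0

/-- The operator `∂^β = ∂₁^{β₁} ⋯ ∂ₙ^{βₙ}` on `K[z₁, …, zₙ]`. -/
def partialPow (K : Type*) [Field K] {n : ℕ} (β : Fin n →₀ ℕ) :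
    Module.End K (MvPolynomial (Fin n) K) :=
  (List.ofFn fun i : Fin n =>
    ((pderiv i).toLinearMap : Module.End K (MvPolynomial (Fin n) K)) ^ β i).prod

/-- The differential operator `∑ a_{αβ} z^α ∂^β` attached to the polynomial
`F(z, w) = ∑ a_{αβ} z^α w^β`; the variable `z i` is `X (Sum.inl i)` and the variable `w i` is
`X (Sum.inr i)`. -/
def diffOp {K : Type*} [Field K] {n : ℕ} (F : MvPolynomial (Fin n ⊕ Fin n) K) :
    Module.End K (MvPolynomial (Fin n) K) :=
  ∑ m ∈ F.support,
    F.coeff m •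
      (LinearMap.mulLeft K
          (monomial (Finsupp.sumFinsuppEquivProdFinsupp m).1 (1 : K)) ∘ₗ
        partialPow K (Finsupp.sumFinsuppEquivProdFinsupp m).2)

/-- `F` is the symbol of the operator `T`. -/
def IsSymbol {K : Type*} [Field K] {n : ℕ} (F : MvPolynomial (Fin n ⊕ Fin n) K)
    (T : Module.End K (MvPolynomial (Fin n) K)) : Prop :=
  T = diffOp F

/-- The Weyl algebra `𝒜ₙ[K]`: all finite order linear differential operators with polynomial
coefficients on `K[z₁, …, zₙ]`. -/
def weylAlgebra (K : Type*) [Field K] (n : ℕ) :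
    Set (Module.End K (MvPolynomial (Fin n) K)) :=
  {T | ∃ F : MvPolynomial (Fin n ⊕ Fin n) K, IsSymbol F T}

/-- `𝒜ₙ(K)`: the nonzero operators in the Weyl algebra that map each stable polynomial over `K`
to a stable polynomial or to `0`. For `K = ℂ` these are the stability preservers, for `K = ℝ` the
real stability preservers. -/
def stabilityPreservers (K : Type*) [Field K] [Algebra K ℂ] (n : ℕ) :
    Set (Module.End K (MvPolynomial (Fin n) K)) :=
  {T | T ∈ weylAlgebra K n ∧ T ≠ 0 ∧
    ∀ f : MvPolynomial (Fin n) K, IsStable f → IsStable (T f) ∨ T f = 0}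

/-- The polynomial `F(μz, νw) = F(μ₁z₁, …, μₙzₙ, ν₁w₁, …, νₙwₙ)`. -/
def scale {K : Type*} [Field K] [Algebra ℝ K] {n : ℕ} (μ ν : Fin n → ℝ)
    (F : MvPolynomial (Fin n ⊕ Fin n) K) : MvPolynomial (Fin n ⊕ Fin n) K :=
  bind₁ (Sum.elim
    (fun i => C (algebraMap ℝ K (μ i)) * X (Sum.inl i))
    (fun i => C (algebraMap ℝ K (ν i)) * X (Sum.inr i))) F

end WeylStab

end

/-!
Write `T_F` for the operator with symbol `F`. For fixed `z`, Taylor expansion at `μ z` gives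

  `(T_{F(μz, νw)} f)(z) = (T_F g_z)(μ z)`,  where `g_z(x) = f((1 - ν μ) z + ν x)`.

If `f` is stable, `μ, ν ∈ [0, 1]` and `z` lies in the product `H` of the upper half-planes, then
`g_z` is stable as a polynomial in `x` (`isStable_interpolate`); this is where `μ, ν ≤ 1` enters.
So for a complex stability preserver `T_F` and `μ > 0` the right-hand side is nonzero unless
`T_F g_z = 0`. It might happen that `T_F g_z = 0` for some `z` only. To exclude this, `g_z` is
multiplied by the stable polynomial `u_v(x) = ∏ (1 - i v_j x_j)^N` with small `v_j > 0`. For `N` at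
least the degree of `F` and suitable arbitrarily small `v`, the map `g ↦ T_F (g u_v)` is injective
on polynomials (`exists_small_damping`): if `b(x) ∂^β` is the term of `T_F` with the largest `∂^β`
in a monomial order, and `b` does not vanish at the zero `(-i / v_j)_j` of `u_v`, then the smallest
term of the Taylor expansion of `g u_v` at this zero survives. Letting `v → 0` and `μ' → μ` with
`μ' > 0`, an elementary Hurwitz argument (`paramEval_one_eq_zero`) shows that `T_{F(μz, νw)} f` is
stable or zero (`isStable_or_zero_diffOp_scale`).

For a real stability preserver the argument needs `T_F (f u_v)` to be stable or zero for complex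
stable `f` (`isStable_or_zero_of_real`). Write `f u_v = p + i q` with real `p` and `q`. All real
combinations of `p` and `q` are stable, so those of `T_F p` and `T_F q` are stable or zero, and thus
`T_F p + i T_F q` is stable, zero, or without zeros in the product of the lower half-planes
(`stable_or_conj_stable_or_zero`). The last case does not occur: `u_v` vanishes at `(-i / v_j)_j` to
an order exceeding that of `T_F`, so `T_F (f u_v)` vanishes there as well.
-/

noncomputable section

namespace WeylStab

open MvPolynomial Filter Topology

variable {n : ℕ}

/-! ### Differential operators and Taylor coefficients -/

/-- The polynomial `g(x + ξ)` in the variables `ξ`. -/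
def translate {σ R : Type*} [CommRing R] (x : σ → R) : MvPolynomial σ R →ₐ[R] MvPolynomial σ R :=
  aeval fun i => X i + C (x i)

@[simp]
theorem translate_X {σ R : Type*} [CommRing R] (x : σ → R) (i : σ) :
    translate x (X i) = X i + C (x i) := by
  simp [translate]

@[simp]
theorem translate_C {σ R : Type*} [CommRing R] (x : σ → R) (c : R) :
    translate x (C c) = C c := by
  simp [translate, algebraMap_eq]

theorem eval_translate {σ R : Type*} [CommRing R] (x y : σ → R) (g : MvPolynomial σ R) :
    eval y (translate x g) = eval (y + x) g := by
  induction g using MvPolynomial.induction_on with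
  | C a => simp
  | add p q hp hq => simp [hp, hq]
  | mul_X p i hp => simp [hp]

theorem coeff_zero_translate {σ R : Type*} [CommRing R] (x : σ → R) (g : MvPolynomial σ R) :
    coeff 0 (translate x g) = eval x g := by
  rw [← constantCoeff_eq, ← eval_zero, eval_translate, zero_add]

theorem translate_translate_neg {σ R : Type*} [CommRing R] (x : σ → R) (g : MvPolynomial σ R) :
    translate (-x) (translate x g) = g := by
  induction g using MvPolynomial.induction_on with
  | C a => simp
  | add p q hp hq => simp [hp, hq]
  | mul_X p i hp => simp [hp]

theorem translate_injective {σ R : Type*} [CommRing R] (x : σ → R) :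
    Function.Injective (translate x : MvPolynomial σ R → MvPolynomial σ R) :=
  Function.LeftInverse.injective (translate_translate_neg x)

theorem translate_pderiv {σ R : Type*} [CommRing R] (x : σ → R) (i : σ) (g : MvPolynomial σ R) :
    translate x (pderiv i g) = pderiv i (translate x g) := by
  classical
  induction g using MvPolynomial.induction_on with
  | C a => simp
  | add p q hp hq => simp [hp, hq]
  | mul_X p j hp =>
    simp only [Derivation.leibniz, map_add, smul_eq_mul, map_mul, hp, translate_X, pderiv_X,
      pderiv_C, add_zero]
    by_cases h : j = i
    · subst h; simp
    · simp [h]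

theorem coeff_pderiv_pow {K : Type*} [Field K] (i : Fin n) (k : ℕ) (m : Fin n →₀ ℕ)
    (g : MvPolynomial (Fin n) K) :
    coeff m ((((pderiv i).toLinearMap : Module.End K (MvPolynomial (Fin n) K)) ^ k) g) =
      ((m i + 1).ascFactorial k : K) * coeff (m + Finsupp.single i k) g := by
  induction k generalizing m g with
  | zero => simp
  | succ k ih =>
    rw [pow_succ, Module.End.mul_apply, ih]
    change _ * coeff _ (pderiv i g) = _
    rw [coeff_pderiv, add_assoc, ← Finsupp.single_add, Nat.ascFactorial_succ]
    simp only [Finsupp.add_apply, Finsupp.single_eq_same]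
    push_cast
    ring

theorem coeff_partialPow {K : Type*} [Field K] (β m : Fin n →₀ ℕ)
    (g : MvPolynomial (Fin n) K) :
    coeff m (partialPow K β g) =
      ((∏ i, (m i + 1).ascFactorial (β i) : ℕ) : K) * coeff (m + β) g := by
  have key : ∀ l : List (Fin n), l.Nodup → ∀ m : Fin n →₀ ℕ,
      coeff m ((l.map fun i => ((pderiv i).toLinearMap :
        Module.End K (MvPolynomial (Fin n) K)) ^ β i).prod g) =
      ((l.map fun i => (m i + 1).ascFactorial (β i)).prod : ℕ) *
        coeff (m + (l.map fun i => Finsupp.single i (β i)).sum) g := by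
    intro l
    induction l with
    | nil => intro _ m; simp
    | cons a l ih =>
      intro hl m
      rw [List.nodup_cons] at hl
      simp only [List.map_cons, List.prod_cons, List.sum_cons, Module.End.mul_apply]
      rw [coeff_pderiv_pow, ih hl.2]
      have : (l.map fun i => ((m + Finsupp.single a (β a)) i + 1).ascFactorial (β i)) =
          l.map fun i => (m i + 1).ascFactorial (β i) := by
        refine List.map_congr_left fun i hi => ?_
        have : a ≠ i := fun h => hl.1 (h ▸ hi)
        simp [Finsupp.single_eq_of_ne' this]
      rw [this, add_assoc]
      push_cast
      ring
  have h := key (List.finRange n) (List.nodup_finRange n) m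
  rw [← List.ofFn_eq_map, ← List.ofFn_eq_map, ← List.ofFn_eq_map, List.prod_ofFn,
    List.sum_ofFn] at h
  have hβ : ∑ i, Finsupp.single i (β i) = β := by
    ext j
    simp
  rw [hβ] at h
  exact h

theorem translate_partialPow {K : Type*} [Field K] (x : Fin n → K) (β : Fin n →₀ ℕ)
    (g : MvPolynomial (Fin n) K) :
    translate x (partialPow K β g) = partialPow K β (translate x g) := by
  have hpow : ∀ (i : Fin n) (k : ℕ) (g : MvPolynomial (Fin n) K),
      translate x ((((pderiv i).toLinearMap : Module.End K (MvPolynomial (Fin n) K)) ^ k) g) =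
      (((pderiv i).toLinearMap : Module.End K (MvPolynomial (Fin n) K)) ^ k) (translate x g) := by
    intro i k
    induction k with
    | zero => intro g; simp
    | succ k ih =>
      intro g
      rw [pow_succ', Module.End.mul_apply, Module.End.mul_apply, ← ih]
      exact translate_pderiv x i _
  have key : ∀ l : List (Fin n),
      translate x ((l.map fun i => ((pderiv i).toLinearMap :
        Module.End K (MvPolynomial (Fin n) K)) ^ β i).prod g) =
      (l.map fun i => ((pderiv i).toLinearMap :
        Module.End K (MvPolynomial (Fin n) K)) ^ β i).prod (translate x g) := by
    intro l
    induction l with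
    | nil => simp
    | cons a l ih => simp only [List.map_cons, List.prod_cons, Module.End.mul_apply, hpow, ih]
  have h := key (List.finRange n)
  rw [← List.ofFn_eq_map] at h
  exact h

theorem eval_partialPow {K : Type*} [Field K] (x : Fin n → K) (β : Fin n →₀ ℕ)
    (g : MvPolynomial (Fin n) K) :
    eval x (partialPow K β g) = ((∏ i, (β i).factorial : ℕ) : K) * coeff β (translate x g) := by
  rw [← coeff_zero_translate, translate_partialPow, coeff_partialPow]
  simp [Nat.one_ascFactorial]

/-- The exponent of `z` in a monomial of a symbol. -/
abbrev zExp (m : Fin n ⊕ Fin n →₀ ℕ) : Fin n →₀ ℕ := (Finsupp.sumFinsuppEquivProdFinsupp m).1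

/-- The exponent of `w` in a monomial of a symbol. -/
abbrev wExp (m : Fin n ⊕ Fin n →₀ ℕ) : Fin n →₀ ℕ := (Finsupp.sumFinsuppEquivProdFinsupp m).2

theorem diffOp_apply {K : Type*} [Field K] (F : MvPolynomial (Fin n ⊕ Fin n) K)
    (g : MvPolynomial (Fin n) K) :
    diffOp F g = ∑ m ∈ F.support,
      F.coeff m • (monomial (zExp m) 1 * partialPow K (wExp m) g) := by
  simp only [diffOp, LinearMap.sum_apply, LinearMap.smul_apply, LinearMap.comp_apply,
    LinearMap.mulLeft_apply]

/-- The value `∑ a_{αβ} x^α ∂^β h(0)` of the operator with symbol `F`, applied to `h(· - x)`, at the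
point `x`. It is meaningful over every `ℂ`-algebra, which allows `x` and `h` to depend polynomially
on parameters. -/
def symbolPairing {R : Type*} [CommRing R] [Algebra ℂ R] (F : MvPolynomial (Fin n ⊕ Fin n) ℂ)
    (x : Fin n → R) (h : MvPolynomial (Fin n) R) : R :=
  ∑ m ∈ F.support, algebraMap ℂ R (F.coeff m) * ((∏ i, x i ^ zExp m i) *
    (((∏ i, (wExp m i).factorial : ℕ) : R) * coeff (wExp m) h))

theorem symbolPairing_eq_sum_of_subset {R : Type*} [CommRing R] [Algebra ℂ R]
    (F : MvPolynomial (Fin n ⊕ Fin n) ℂ) (x : Fin n → R) (h : MvPolynomial (Fin n) R)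
    {s : Finset (Fin n ⊕ Fin n →₀ ℕ)} (hs : F.support ⊆ s) :
    symbolPairing F x h = ∑ m ∈ s, algebraMap ℂ R (F.coeff m) * ((∏ i, x i ^ zExp m i) *
      (((∏ i, (wExp m i).factorial : ℕ) : R) * coeff (wExp m) h)) := by
  refine Finset.sum_subset hs fun m _ hm => ?_
  rw [notMem_support_iff.1 hm]
  simp

theorem eval_diffOp (F : MvPolynomial (Fin n ⊕ Fin n) ℂ) (g : MvPolynomial (Fin n) ℂ)
    (x : Fin n → ℂ) :
    eval x (diffOp F g) = symbolPairing F x (translate x g) := by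
  rw [diffOp_apply, symbolPairing, map_sum]
  refine Finset.sum_congr rfl fun m _ => ?_
  rw [smul_eval, map_mul, eval_partialPow, eval_monomial, Finsupp.prod_fintype _ _ (by simp)]
  simp

theorem map_symbolPairing {R S : Type*} [CommRing R] [Algebra ℂ R] [CommRing S] [Algebra ℂ S]
    (φ : R →ₐ[ℂ] S) (F : MvPolynomial (Fin n ⊕ Fin n) ℂ) (x : Fin n → R)
    (h : MvPolynomial (Fin n) R) :
    φ (symbolPairing F x h) = symbolPairing F (fun i => φ (x i)) (mapAlgHom φ h) := by
  simp [symbolPairing, coeff_map]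

theorem coeff_scale {K : Type*} [Field K] [Algebra ℝ K] (μ ν : Fin n → ℝ)
    (F : MvPolynomial (Fin n ⊕ Fin n) K) (m : Fin n ⊕ Fin n →₀ ℕ) :
    coeff m (scale μ ν F) =
      (∏ i, algebraMap ℝ K (μ i) ^ zExp m i) * (∏ i, algebraMap ℝ K (ν i) ^ wExp m i) *
        coeff m F := by
  classical
  induction F using MvPolynomial.induction_on' with
  | add p q hp hq =>
    have : scale μ ν (p + q) = scale μ ν p + scale μ ν q := by simp [scale]
    rw [this, coeff_add, hp, hq, coeff_add, mul_add]
  | monomial u a =>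
    have : scale μ ν (monomial u a) = C ((∏ i, algebraMap ℝ K (μ i) ^ zExp u i) *
        (∏ i, algebraMap ℝ K (ν i) ^ wExp u i)) * monomial u a := by
      rw [scale, bind₁, aeval_monomial, monomial_eq, Finsupp.prod_fintype _ _ (by simp),
        Finsupp.prod_fintype _ _ (by simp), Fintype.prod_sum_type, Fintype.prod_sum_type]
      simp only [Sum.elim_inl, Sum.elim_inr, mul_pow, Finset.prod_mul_distrib, map_mul, map_prod,
        map_pow, algebraMap_eq, Finsupp.fst_sumFinsuppEquivProdFinsupp,
        Finsupp.snd_sumFinsuppEquivProdFinsupp]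
      ring
    rw [this, coeff_C_mul, coeff_monomial]
    split_ifs with h
    · rw [h]
    · simp

/-- Scaling a symbol by `(μ, ν)` at the point `z` amounts to evaluating the original symbol at
`μ z` and rescaling the increment variable of the test polynomial by `ν`. -/
theorem symbolPairing_scale (F : MvPolynomial (Fin n ⊕ Fin n) ℂ) (μ ν : Fin n → ℝ)
    (x : Fin n → ℂ) (h : MvPolynomial (Fin n) ℂ) :
    symbolPairing (scale μ ν F) x h =
      symbolPairing F (fun i => (μ i : ℂ) * x i)
        (aeval (fun i => C (ν i : ℂ) * X i) h) := by
  classical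
  have hsub : (scale μ ν F).support ⊆ F.support := by
    intro m hm
    rw [mem_support_iff, coeff_scale] at hm
    exact mem_support_iff.2 (right_ne_zero_of_mul hm)
  have hc : ∀ (β : Fin n →₀ ℕ) (h : MvPolynomial (Fin n) ℂ),
      coeff β (aeval (fun i => C (ν i : ℂ) * X i) h : MvPolynomial (Fin n) ℂ) =
        (∏ i, (ν i : ℂ) ^ β i) * coeff β h := by
    intro β h
    induction h using MvPolynomial.induction_on' with
    | add p q hp hq => rw [map_add, coeff_add, hp, hq, coeff_add, mul_add]
    | monomial u a =>
      have : (aeval (fun i => C (ν i : ℂ) * X i) (monomial u a) : MvPolynomial (Fin n) ℂ) =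
          C (∏ i, (ν i : ℂ) ^ u i) * monomial u a := by
        rw [aeval_monomial, monomial_eq, Finsupp.prod_fintype _ _ (by simp),
          Finsupp.prod_fintype _ _ (by simp)]
        simp only [mul_pow, Finset.prod_mul_distrib, map_prod, map_pow, algebraMap_eq]
        ring
      rw [this, coeff_C_mul, coeff_monomial]
      split_ifs with h
      · rw [h]
      · simp
  rw [symbolPairing_eq_sum_of_subset _ _ _ hsub, symbolPairing]
  refine Finset.sum_congr rfl fun m _ => ?_
  rw [coeff_scale, hc]
  simp only [mul_pow, Finset.prod_mul_distrib, Algebra.algebraMap_self, RingHom.id_apply,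
    Complex.coe_algebraMap]
  ring

/-! ### Operators do not annihilate polynomials vanishing to high order at a generic point -/

/-- If `ε` is the smallest exponent of `G` and `β ≤ β₀` in a monomial order, then the coefficient of
`A ∂^β G` at `ε - β₀` only sees the constant term of `A` and the term of `G` at `ε`, and is zero
for `β ≠ β₀`. -/
theorem coeff_mul_partialPow_of_le (mo : MonomialOrder (Fin n)) {β β₀ ε e : Fin n →₀ ℕ}
    {G : MvPolynomial (Fin n) ℂ} (hβ : mo.toSyn β ≤ mo.toSyn β₀)
    (hε : ∀ d ∈ G.support, mo.toSyn ε ≤ mo.toSyn d) (he : e + β₀ = ε)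
    (A : MvPolynomial (Fin n) ℂ) :
    coeff e (A * partialPow ℂ β G) = if β = β₀ then
      coeff 0 A * (((∏ i, (e i + 1).ascFactorial (β₀ i) : ℕ) : ℂ) * coeff ε G) else 0 := by
  classical
  have key : ∀ a b : Fin n →₀ ℕ, a + b = e → coeff (b + β) G ≠ 0 → a = 0 ∧ β = β₀ := by
    intro a b hab hb
    have h1 := hε _ (mem_support_iff.2 hb)
    rw [← he, ← hab, add_comm a b, add_assoc, map_add, map_add mo.toSyn b β] at h1
    have h2 := le_of_add_le_add_left h1
    rw [map_add] at h2
    have h0 : 0 ≤ mo.toSyn a := by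
      rw [← map_zero mo.toSyn]
      exact mo.toSyn_monotone zero_le
    have h3 : mo.toSyn β = mo.toSyn β₀ :=
      le_antisymm hβ ((le_add_of_nonneg_left h0).trans h2)
    have h4 : mo.toSyn a ≤ 0 := by
      rw [h3] at h2
      exact le_of_add_le_add_right (h2.trans (zero_add _).ge)
    refine ⟨?_, mo.toSyn.injective h3⟩
    exact mo.toSyn.injective ((le_antisymm h4 h0).trans (map_zero mo.toSyn).symm)
  rw [coeff_mul]
  split_ifs with h
  · subst h
    rw [Finset.sum_eq_single (0, e)]
    · rw [coeff_partialPow, he]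
    · rintro ⟨a, b⟩ hab hne
      replace hab : a + b = e := by simpa using hab
      rw [coeff_partialPow]
      by_contra hcon
      obtain ⟨rfl, -⟩ := key a b hab
        (right_ne_zero_of_mul (right_ne_zero_of_mul hcon))
      exact hne (by simp [← hab])
    · intro hcon
      exact absurd (by simp) hcon
  · refine Finset.sum_eq_zero ?_
    rintro ⟨a, b⟩ hab
    replace hab : a + b = e := by simpa using hab
    rw [coeff_partialPow]
    by_contra hcon
    exact h (key a b hab (right_ne_zero_of_mul (right_ne_zero_of_mul hcon))).2

/-- The coefficient `b` of the largest power `∂^β` occurring in a nonzero operator controls its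
kernel: wherever `b` does not vanish, the operator does not annihilate a nonzero polynomial all of
whose Taylor exponents dominate `β`, since the smallest Taylor exponent survives. -/
theorem exists_leading_coeff {F : MvPolynomial (Fin n ⊕ Fin n) ℂ} (hF : F ≠ 0) :
    ∃ m₀ ∈ F.support, ∃ b : MvPolynomial (Fin n) ℂ, b ≠ 0 ∧
      ∀ (p : Fin n → ℂ) (g : MvPolynomial (Fin n) ℂ), eval p b ≠ 0 → g ≠ 0 →
        (∀ e ∈ (translate p g).support, wExp m₀ ≤ e) → diffOp F g ≠ 0 := by
  classical
  let mo : MonomialOrder (Fin n) := MonomialOrder.lex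
  obtain ⟨m₀, hm₀, hmax⟩ := F.support.exists_max_image (fun m => mo.toSyn (wExp m))
    (Finset.nonempty_iff_ne_empty.2 (by simpa using hF))
  let b : MvPolynomial (Fin n) ℂ :=
    ∑ m ∈ F.support, if wExp m = wExp m₀ then monomial (zExp m) (coeff m F) else 0
  refine ⟨m₀, hm₀, b, ?_, ?_⟩
  · have hb : coeff (zExp m₀) b = coeff m₀ F := by
      rw [coeff_sum, Finset.sum_eq_single m₀]
      · simp
      · intro m _ hne
        split_ifs with h
        · rw [coeff_monomial, if_neg]
          intro h'
          exact hne (Finsupp.sumFinsuppEquivProdFinsupp.injective (Prod.ext h' h))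
        · simp
      · intro h
        exact absurd hm₀ h
    intro h0
    rw [h0, coeff_zero] at hb
    exact mem_support_iff.1 hm₀ hb.symm
  · intro p g hp hg hge hzero
    have hG : translate p g ≠ 0 := fun h => hg (translate_injective p (h.trans (map_zero _).symm))
    set G := translate p g with hGdef
    obtain ⟨ε, hε, hmin⟩ := G.support.exists_min_image (fun m => mo.toSyn m)
      (Finset.nonempty_iff_ne_empty.2 (by simpa using hG))
    have he : ε - wExp m₀ + wExp m₀ = ε := tsub_add_cancel_of_le (hge ε hε)
    have h1 : coeff (ε - wExp m₀) (translate p (diffOp F g)) =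
        eval p b * (((∏ i, ((ε - wExp m₀) i + 1).ascFactorial (wExp m₀ i) : ℕ) : ℂ) *
          coeff ε G) := by
      rw [diffOp_apply, map_sum, coeff_sum, map_sum, Finset.sum_mul]
      refine Finset.sum_congr rfl fun m hm => ?_
      rw [map_smul, coeff_smul, map_mul, translate_partialPow,
        coeff_mul_partialPow_of_le mo (hmax m hm) hmin he, coeff_zero_translate]
      split_ifs with h
      · rw [eval_monomial, eval_monomial, smul_eq_mul]
        ring
      · simp
    rw [hzero, map_zero, coeff_zero] at h1
    refine mul_ne_zero hp (mul_ne_zero ?_ (mem_support_iff.1 hε)) h1.symm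
    rw [Nat.cast_ne_zero]
    exact Finset.prod_ne_zero_iff.2 fun i _ => (Nat.ascFactorial_pos _ _).ne'

/-- The polynomial `∏ (1 - i v_j x_j)^N`, an approximation of `1` which for `v > 0` is stable and
vanishes to high order at the point `(-i / v_j)_j`. -/
def damping {R : Type*} [CommRing R] [Algebra ℂ R] (N : ℕ) (v : Fin n → R)
    (x : Fin n → R) : R :=
  ∏ j, (1 - algebraMap ℂ R Complex.I * v j * x j) ^ N

theorem map_damping {R S : Type*} [CommRing R] [Algebra ℂ R] [CommRing S] [Algebra ℂ S]
    (φ : R →ₐ[ℂ] S) (N : ℕ) (v x : Fin n → R) :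
    φ (damping N v x) = damping N (fun j => φ (v j)) (fun j => φ (x j)) := by
  simp [damping]

/-- `damping` as a polynomial in `x`. -/
def dampingPoly (N : ℕ) (v : Fin n → ℝ) : MvPolynomial (Fin n) ℂ :=
  damping N (fun j => C (v j : ℂ)) X

theorem eval_dampingPoly (N : ℕ) (v : Fin n → ℝ) (x : Fin n → ℂ) :
    eval x (dampingPoly N v) = ∏ j, (1 - Complex.I * v j * x j) ^ N := by
  simp [dampingPoly, damping, algebraMap_eq]

/-- The zero of `dampingPoly` in the product of the lower half-planes. -/
def dampingZero (v : Fin n → ℝ) : Fin n → ℂ := fun j => -Complex.I / v j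

theorem le_of_mem_support_translate_mul_dampingPoly {N : ℕ} {v : Fin n → ℝ} (hv : ∀ j, 0 < v j)
    (f : MvPolynomial (Fin n) ℂ) {e : Fin n →₀ ℕ}
    (he : e ∈ (translate (dampingZero v) (f * dampingPoly N v)).support) (j : Fin n) :
    N ≤ e j := by
  classical
  have h1 : translate (dampingZero v) (dampingPoly N v) =
      C (∏ j, (-(Complex.I * v j)) ^ N) *
        monomial (Finsupp.equivFunOnFinite.symm fun _ => N) 1 := by
    rw [dampingPoly, damping, map_prod, monomial_eq, Finsupp.prod_fintype _ _ (by simp)]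
    simp only [map_prod, map_pow, map_one, one_mul, Finsupp.equivFunOnFinite_symm_apply_apply]
    rw [← Finset.prod_mul_distrib]
    refine Finset.prod_congr rfl fun j _ => ?_
    rw [← mul_pow]
    congr 1
    have h2 : Complex.I * v j * dampingZero v j = 1 := by
      have : (v j : ℂ) ≠ 0 := by exact_mod_cast (hv j).ne'
      rw [dampingZero]
      field_simp
      simp
    simp only [algebraMap_eq, map_sub, map_one, map_mul, translate_C, translate_X]
    rw [mul_add, ← C_mul, ← C_mul, h2, C_neg, C_mul, C_1]
    ring
  rw [map_mul, h1, ← mul_assoc, mem_support_iff, coeff_mul_monomial'] at he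
  split_ifs at he with h
  · simpa using h j
  · exact absurd rfl he

theorem wExp_le_totalDegree {K : Type*} [Field K] {F : MvPolynomial (Fin n ⊕ Fin n) K}
    {m : Fin n ⊕ Fin n →₀ ℕ} (hm : m ∈ F.support) (j : Fin n) : wExp m j ≤ F.totalDegree := by
  have h1 : wExp m j = m (Sum.inr j) := Finsupp.snd_sumFinsuppEquivProdFinsupp m j
  rw [h1]
  refine le_trans ?_ (le_totalDegree hm)
  exact Finsupp.le_degree (Sum.inr j) m

theorem exists_small_damping {F : MvPolynomial (Fin n ⊕ Fin n) ℂ} (hF : F ≠ 0) {N : ℕ}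
    (hN : F.totalDegree ≤ N) {δ : ℝ} (hδ : 0 < δ) :
    ∃ v : Fin n → ℝ, (∀ j, 0 < v j) ∧ (∀ j, v j < δ) ∧
      ∀ f : MvPolynomial (Fin n) ℂ, f ≠ 0 → diffOp F (f * dampingPoly N v) ≠ 0 := by
  obtain ⟨m₀, hm₀, b, hb, hker⟩ := exists_leading_coeff hF
  let S : Set ℂ := (fun t : ℝ => -Complex.I / t) '' Set.Ioo 0 δ
  have hS : S.Infinite := by
    refine (Set.Ioo_infinite hδ).image ?_
    intro s _ t _ hst
    have : ((s : ℂ))⁻¹ = ((t : ℂ))⁻¹ := by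
      simpa [div_eq_mul_inv] using hst
    exact_mod_cast inv_injective this
  have hex : ∃ p ∈ Set.pi Set.univ (fun _ : Fin n => S), eval p b ≠ 0 := by
    by_contra! hcon
    exact hb (funext_set (fun _ => S) (fun _ => hS) fun x hx => (hcon x hx).trans (map_zero _).symm)
  obtain ⟨p, hp, hpb⟩ := hex
  choose v hv hvp using fun j => hp j (Set.mem_univ j)
  have hpv : p = dampingZero v := by
    ext j
    exact (hvp j).symm
  refine ⟨v, fun j => (hv j).1, fun j => (hv j).2, fun f hf => ?_⟩
  refine hker p _ hpb (mul_ne_zero hf ?_) fun e he j => ?_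
  · intro h0
    have h1 := eval_dampingPoly N v 0
    rw [h0] at h1
    simp at h1
  · rw [hpv] at he
    exact ((wExp_le_totalDegree hm₀ j).trans hN).trans
      (le_of_mem_support_translate_mul_dampingPoly (fun j => (hv j).1) f he j)

/-! ### Complexification of real operators -/

theorem isStable_iff_eval {f : MvPolynomial (Fin n) ℂ} :
    IsStable f ↔ ∀ z : Fin n → ℂ, (∀ i, 0 < (z i).im) → eval z f ≠ 0 :=
  Iff.rfl

theorem isStable_map_iff {f : MvPolynomial (Fin n) ℝ} :
    IsStable (map (algebraMap ℝ ℂ) f) ↔ IsStable f := by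
  simp only [IsStable, aeval_map_algebraMap]

theorem IsStable.ne_zero {f : MvPolynomial (Fin n) ℂ} (hf : IsStable f) : f ≠ 0 := by
  rintro rfl
  exact hf (fun _ => Complex.I) (by simp) (map_zero _)

theorem IsStable.mul {f g : MvPolynomial (Fin n) ℂ} (hf : IsStable f) (hg : IsStable g) :
    IsStable (f * g) := fun z hz => by
  rw [map_mul]
  exact mul_ne_zero (hf z hz) (hg z hz)

theorem diffOp_map (F : MvPolynomial (Fin n ⊕ Fin n) ℝ) (f : MvPolynomial (Fin n) ℝ) :
    diffOp (map (algebraMap ℝ ℂ) F) (map (algebraMap ℝ ℂ) f) =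
      map (algebraMap ℝ ℂ) (diffOp F f) := by
  have hp : ∀ β : Fin n →₀ ℕ, partialPow ℂ β (map (algebraMap ℝ ℂ) f) =
      map (algebraMap ℝ ℂ) (partialPow ℝ β f) := by
    intro β
    ext m
    simp [coeff_partialPow, coeff_map]
  rw [diffOp_apply, diffOp_apply, support_map_of_injective _ (algebraMap ℝ ℂ).injective, map_sum]
  refine Finset.sum_congr rfl fun m _ => ?_
  rw [hp, coeff_map, smul_eq_C_mul, smul_eq_C_mul, map_mul, map_C, map_mul, map_monomial,
    (algebraMap ℝ ℂ).map_one]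

theorem exists_re_im (f : MvPolynomial (Fin n) ℂ) : ∃ p q : MvPolynomial (Fin n) ℝ,
    f = map (algebraMap ℝ ℂ) p + Complex.I • map (algebraMap ℝ ℂ) q := by
  induction f using MvPolynomial.induction_on with
  | C a =>
    refine ⟨C a.re, C a.im, ?_⟩
    rw [map_C, map_C, smul_eq_C_mul, ← C_mul, ← C_add]
    congr 1
    rw [mul_comm]
    exact (Complex.re_add_im a).symm
  | add f g hf hg =>
    obtain ⟨p, q, rfl⟩ := hf
    obtain ⟨p', q', rfl⟩ := hg
    refine ⟨p + p', q + q', ?_⟩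
    simp only [map_add, smul_add]
    abel
  | mul_X f i hf =>
    obtain ⟨p, q, rfl⟩ := hf
    refine ⟨p * X i, q * X i, ?_⟩
    simp only [map_mul, map_X, add_mul, smul_mul_assoc]

theorem eval_conj_map (p : MvPolynomial (Fin n) ℝ) (z : Fin n → ℂ) :
    eval (fun i => (starRingEnd ℂ) (z i)) (map (algebraMap ℝ ℂ) p) =
      (starRingEnd ℂ) (eval z (map (algebraMap ℝ ℂ) p)) := by
  induction p using MvPolynomial.induction_on with
  | C a => simp
  | add p q hp hq => simp only [map_add, hp, hq]
  | mul_X p i hp => simp only [map_mul, map_X, eval_X, hp]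

/-! ### Real and imaginary parts of stable polynomials -/

/-- A comparison of two values of a polynomial, factor by factor over its roots. -/
theorem norm_eval_le_of_roots {φ : Polynomial ℂ} {a b : ℂ} {M : ℝ}
    (h : ∀ r, φ.eval r = 0 → ‖a - r‖ ≤ M * ‖b - r‖) (hM : 0 ≤ M) :
    ‖φ.eval a‖ ≤ M ^ φ.natDegree * ‖φ.eval b‖ := by
  by_cases h0 : φ = 0
  · simp [h0]
  have hs := IsAlgClosed.splits φ
  have key : ∀ s : Multiset ℂ, (∀ r ∈ s, ‖a - r‖ ≤ M * ‖b - r‖) →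
      ‖(s.map fun r => a - r).prod‖ ≤ M ^ s.card * ‖(s.map fun r => b - r).prod‖ := by
    intro s
    induction s using Multiset.induction_on with
    | empty => simp
    | cons r s ih =>
      intro h
      simp only [Multiset.map_cons, Multiset.prod_cons, norm_mul, Multiset.card_cons, pow_succ]
      calc ‖a - r‖ * ‖(s.map fun r => a - r).prod‖
          ≤ (M * ‖b - r‖) * (M ^ s.card * ‖(s.map fun r => b - r).prod‖) := by
            refine mul_le_mul (h r (Multiset.mem_cons_self r s))
              (ih fun r hr => h r (Multiset.mem_cons_of_mem hr)) (norm_nonneg _) ?_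
            positivity
        _ = _ := by ring
  have hr := key φ.roots fun r hr => h r ((Polynomial.mem_roots h0).1 hr)
  rw [← hs.natDegree_eq_card_roots] at hr
  rw [hs.eval_eq_prod_roots, hs.eval_eq_prod_roots, norm_mul, norm_mul]
  calc _ ≤ ‖φ.leadingCoeff‖ * (M ^ φ.natDegree * ‖(φ.roots.map fun r => b - r).prod‖) :=
        mul_le_mul_of_nonneg_left hr (norm_nonneg _)
    _ = _ := by ring

/-- On the line `t ↦ Re z + t Im z` all roots of a stable polynomial lie in the closed lower
half-plane, hence at least as close to `-i` as to `i`. -/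
theorem IsStable.norm_eval_conj_le {f : MvPolynomial (Fin n) ℂ} (hf : IsStable f)
    {z : Fin n → ℂ} (hz : ∀ i, 0 < (z i).im) :
    ‖eval (fun i => (starRingEnd ℂ) (z i)) f‖ ≤ ‖eval z f‖ := by
  rw [isStable_iff_eval] at hf
  let φ : Polynomial ℂ := aeval
    (fun i => Polynomial.C ((z i).re : ℂ) + Polynomial.C ((z i).im : ℂ) * Polynomial.X) f
  have hφ : ∀ s : ℂ, φ.eval s = eval (fun i => ((z i).re : ℂ) + ((z i).im : ℂ) * s) f := by
    intro s
    change Polynomial.aeval s (aeval _ f) = aeval _ f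
    rw [comp_aeval_apply]
    simp
  have h := norm_eval_le_of_roots (φ := φ) (a := -Complex.I) (b := Complex.I) (M := 1) ?_ zero_le_one
  · rw [hφ, hφ, one_pow, one_mul] at h
    have h1 : (fun i => ((z i).re : ℂ) + ((z i).im : ℂ) * -Complex.I) =
        fun i => (starRingEnd ℂ) (z i) := by
      ext1 i
      apply Complex.ext <;> simp
    have h2 : (fun i => ((z i).re : ℂ) + ((z i).im : ℂ) * Complex.I) = z := by
      ext1 i
      apply Complex.ext <;> simp
    rwa [h1, h2] at h
  · intro r hr
    have hr' : r.im ≤ 0 := by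
      by_contra! hpos
      rw [hφ] at hr
      refine hf _ (fun i => ?_) hr
      simpa using mul_pos (hz i) hpos
    rw [one_mul]
    refine le_of_pow_le_pow_left₀ two_ne_zero (norm_nonneg _) ?_
    rw [← Complex.normSq_eq_norm_sq, ← Complex.normSq_eq_norm_sq]
    simp only [Complex.normSq_apply, Complex.sub_re, Complex.sub_im, Complex.neg_re,
      Complex.neg_im, Complex.I_re, Complex.I_im]
    nlinarith

theorem isStable_dampingPoly (N : ℕ) {v : Fin n → ℝ} (hv : ∀ j, 0 < v j) :
    IsStable (dampingPoly N v) := by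
  rw [isStable_iff_eval]
  intro z hz
  rw [eval_dampingPoly]
  refine Finset.prod_ne_zero_iff.2 fun j _ => pow_ne_zero _ fun h => ?_
  have h1 := congrArg Complex.re h
  simp at h1
  have := mul_pos (hv j) (hz j)
  linarith

theorem norm_eval_conj_dampingPoly_lt [NeZero n] {N : ℕ} (hN : N ≠ 0) {v : Fin n → ℝ}
    (hv : ∀ j, 0 < v j) {z : Fin n → ℂ} (hz : ∀ i, 0 < (z i).im) :
    ‖eval (fun i => (starRingEnd ℂ) (z i)) (dampingPoly N v)‖ < ‖eval z (dampingPoly N v)‖ := by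
  have hprod : ∀ (s : Finset (Fin n)), s.Nonempty → ∀ g h : Fin n → ℝ, (∀ i, 0 ≤ g i) →
      (∀ i, g i < h i) → ∏ i ∈ s, g i < ∏ i ∈ s, h i := by
    intro s hs g h hg hgh
    induction hs using Finset.Nonempty.cons_induction with
    | singleton a => simpa using hgh a
    | cons a s ha hs ih =>
      rw [Finset.prod_cons, Finset.prod_cons]
      exact mul_lt_mul'' (hgh a) ih (hg a) (Finset.prod_nonneg fun i _ => hg i)
  rw [eval_dampingPoly, eval_dampingPoly, norm_prod, norm_prod]
  refine hprod _ Finset.univ_nonempty _ _ (fun i => norm_nonneg _) fun i => ?_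
  rw [norm_pow, norm_pow]
  refine pow_lt_pow_left₀ ?_ (norm_nonneg _) hN
  refine lt_of_pow_lt_pow_left₀ 2 (norm_nonneg _) ?_
  rw [← Complex.normSq_eq_norm_sq, ← Complex.normSq_eq_norm_sq]
  have := mul_pos (hv i) (hz i)
  simp [Complex.normSq_apply]
  nlinarith

/-- If the conjugate reflection of `p + i q` is strictly dominated by `p + i q` on the upper
half-space, then `p` and `q` span a space of stable polynomials. -/
theorem isStable_comb {p q : MvPolynomial (Fin n) ℝ}
    (h : ∀ z : Fin n → ℂ, (∀ i, 0 < (z i).im) →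
      ‖eval (fun i => (starRingEnd ℂ) (z i))
        (map (algebraMap ℝ ℂ) p + Complex.I • map (algebraMap ℝ ℂ) q)‖ <
      ‖eval z (map (algebraMap ℝ ℂ) p + Complex.I • map (algebraMap ℝ ℂ) q)‖)
    {α β : ℝ} (hαβ : α ≠ 0 ∨ β ≠ 0) : IsStable (α • p + β • q) := by
  rw [← isStable_map_iff, isStable_iff_eval]
  intro z hz h0
  have h1 := h z hz
  rw [eval_add, smul_eval, eval_conj_map, eval_conj_map, eval_add, smul_eval] at h1
  simp only [smul_eq_C_mul, map_add, map_mul, map_C, eval_C, Complex.coe_algebraMap] at h0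
  set P := eval z (map (algebraMap ℝ ℂ) p)
  set Q := eval z (map (algebraMap ℝ ℂ) q)
  have hre := congrArg Complex.re h0
  have him := congrArg Complex.im h0
  simp at hre him
  refine absurd (pow_lt_pow_left₀ h1 (norm_nonneg _) two_ne_zero) ?_
  rw [← Complex.normSq_eq_norm_sq, ← Complex.normSq_eq_norm_sq]
  simp only [Complex.normSq_apply, Complex.add_re, Complex.add_im, Complex.mul_re, Complex.mul_im,
    Complex.conj_re, Complex.conj_im, Complex.I_re, Complex.I_im]
  -- proportional values `P` and `Q` satisfy `Im (conj P * Q) = 0`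
  have hcross : P.re * Q.im - P.im * Q.re = 0 := by
    rcases hαβ with hα | hβ
    · refine (mul_eq_zero.1 (?_ : α * _ = 0)).resolve_left hα
      linear_combination Q.im * hre - Q.re * him
    · refine (mul_eq_zero.1 (?_ : β * _ = 0)).resolve_left hβ
      linear_combination P.re * him - P.im * hre
  nlinarith

theorem convex_upperHalfSpace : Convex ℝ {z : Fin n → ℂ | ∀ i, 0 < (z i).im} := by
  intro x hx y hy a b ha hb hab i
  have h1 := hx i
  have h2 := hy i
  simp only [Pi.add_apply, Pi.smul_apply, Complex.add_im, Complex.real_smul, Complex.mul_im,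
    Complex.ofReal_re, Complex.ofReal_im, zero_mul, add_zero]
  rcases ha.eq_or_lt with rfl | ha
  · rw [zero_add] at hab
    subst hab
    linarith
  · have := mul_pos ha h1
    have := mul_nonneg hb h2.le
    linarith

/-- A multivariate Obreschkoff theorem: if all real combinations of `P` and `Q` are stable or zero,
then `P + i Q` or its conjugate is stable, or `P + i Q` vanishes. Unless `P` and `Q` are
proportional, `P / Q` avoids the real axis on the connected set where all variables have positive
imaginary part, and hence stays on one side of it. -/
theorem stable_or_conj_stable_or_zero {P Q : MvPolynomial (Fin n) ℝ}
    (h : ∀ α β : ℝ, α ≠ 0 ∨ β ≠ 0 → IsStable (α • P + β • Q) ∨ α • P + β • Q = 0) :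
    IsStable (map (algebraMap ℝ ℂ) P + Complex.I • map (algebraMap ℝ ℂ) Q) ∨
    (∀ z : Fin n → ℂ, (∀ i, 0 < (z i).im) → eval (fun i => (starRingEnd ℂ) (z i))
      (map (algebraMap ℝ ℂ) P + Complex.I • map (algebraMap ℝ ℂ) Q) ≠ 0) ∨
    map (algebraMap ℝ ℂ) P + Complex.I • map (algebraMap ℝ ℂ) Q = 0 := by
  by_cases hdep : ∃ α β : ℝ, (α ≠ 0 ∨ β ≠ 0) ∧ α • P + β • Q = 0
  · -- both polynomials are multiples of one of them
    have hmul : ∃ (R : MvPolynomial (Fin n) ℝ) (c : ℂ), (IsStable R ∨ R = 0) ∧ c ≠ 0 ∧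
        map (algebraMap ℝ ℂ) P + Complex.I • map (algebraMap ℝ ℂ) Q =
          c • map (algebraMap ℝ ℂ) R := by
      obtain ⟨α, β, hne, h0⟩ := hdep
      by_cases hα : α = 0
      · have hβ : β ≠ 0 := hne.resolve_left (not_not.2 hα)
        have hQ : Q = 0 := by
          rw [hα, zero_smul, zero_add] at h0
          exact (smul_eq_zero.1 h0).resolve_left hβ
        refine ⟨P, 1, ?_, one_ne_zero, by simp [hQ]⟩
        simpa using h 1 0 (Or.inl one_ne_zero)
      · refine ⟨Q, (-(β / α) : ℝ) + Complex.I, ?_, ?_, ?_⟩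
        · simpa using h 0 1 (Or.inr one_ne_zero)
        · intro h1
          have := congrArg Complex.im h1
          simp at this
        · have hP : P = (-(β / α)) • Q := by
            have h2 : α • P = -(β • Q) := eq_neg_of_add_eq_zero_left h0
            rw [neg_smul, div_eq_inv_mul, mul_smul, ← smul_neg, ← h2, smul_smul,
              inv_mul_cancel₀ hα, one_smul]
          rw [add_smul]
          congr 1
          conv_lhs => rw [hP]
          rw [smul_eq_C_mul, map_mul, map_C, smul_eq_C_mul, Complex.coe_algebraMap]
    obtain ⟨R, c, hR, hc, heq⟩ := hmul
    rw [heq]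
    rcases hR with hR | hR
    · left
      rw [← isStable_map_iff, isStable_iff_eval] at hR
      rw [isStable_iff_eval]
      intro z hz
      rw [smul_eval]
      exact mul_ne_zero hc (hR z hz)
    · right; right
      rw [hR, map_zero, smul_zero]
  · push Not at hdep
    have hst : ∀ α β : ℝ, α ≠ 0 ∨ β ≠ 0 → ∀ z : Fin n → ℂ, (∀ i, 0 < (z i).im) →
        (α : ℂ) * eval z (map (algebraMap ℝ ℂ) P) + β * eval z (map (algebraMap ℝ ℂ) Q) ≠ 0 := by
      intro α β hne z hz
      have h1 := (h α β hne).resolve_right (hdep α β hne)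
      rw [← isStable_map_iff, isStable_iff_eval] at h1
      simpa [smul_eq_C_mul] using h1 z hz
    have hQ : ∀ z : Fin n → ℂ, (∀ i, 0 < (z i).im) → eval z (map (algebraMap ℝ ℂ) Q) ≠ 0 :=
      fun z hz => by simpa using hst 0 1 (Or.inr one_ne_zero) z hz
    by_contra! hcon
    obtain ⟨hc1, ⟨z₂, hz₂, hc2⟩, -⟩ := hcon
    rw [isStable_iff_eval] at hc1
    push Not at hc1
    obtain ⟨z₁, hz₁, hc1⟩ := hc1
    let r : (Fin n → ℂ) → ℝ := fun z =>
      (eval z (map (algebraMap ℝ ℂ) P) / eval z (map (algebraMap ℝ ℂ) Q)).im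
    have hcont : ContinuousOn r {z : Fin n → ℂ | ∀ i, 0 < (z i).im} := by
      refine Complex.continuous_im.comp_continuousOn (ContinuousOn.div ?_ ?_ hQ)
      · exact (MvPolynomial.continuous_eval _).continuousOn
      · exact (MvPolynomial.continuous_eval _).continuousOn
    have hr1 : r z₁ = -1 := by
      rw [eval_add, smul_eval] at hc1
      have : eval z₁ (map (algebraMap ℝ ℂ) P) / eval z₁ (map (algebraMap ℝ ℂ) Q) = -Complex.I := by
        rw [div_eq_iff (hQ z₁ hz₁)]
        linear_combination hc1
      change Complex.im _ = _
      rw [this]; simp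
    have hr2 : r z₂ = 1 := by
      rw [eval_add, smul_eval, eval_conj_map, eval_conj_map] at hc2
      have : eval z₂ (map (algebraMap ℝ ℂ) P) / eval z₂ (map (algebraMap ℝ ℂ) Q) = Complex.I := by
        rw [div_eq_iff (hQ z₂ hz₂)]
        have := congrArg (starRingEnd ℂ) hc2
        simp only [map_add, map_mul, Complex.conj_conj, Complex.conj_I, map_zero] at this
        linear_combination this
      change Complex.im _ = _
      rw [this]; simp
    obtain ⟨z, hz, hrz⟩ := convex_upperHalfSpace.isPreconnected.intermediate_value hz₁ hz₂ hcont
      (show (0 : ℝ) ∈ Set.Icc (r z₁) (r z₂) by rw [hr1, hr2]; norm_num)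
    have h3 : eval z (map (algebraMap ℝ ℂ) P) / eval z (map (algebraMap ℝ ℂ) Q) =
        ((eval z (map (algebraMap ℝ ℂ) P) / eval z (map (algebraMap ℝ ℂ) Q)).re : ℂ) := by
      apply Complex.ext
      · simp
      · exact hrz
    rw [div_eq_iff (hQ z hz)] at h3
    refine hst 1 (-(eval z (map (algebraMap ℝ ℂ) P) / eval z (map (algebraMap ℝ ℂ) Q)).re)
      (Or.inl one_ne_zero) z hz ?_
    push_cast
    linear_combination h3

theorem eval_dampingZero_diffOp [NeZero n] {F : MvPolynomial (Fin n ⊕ Fin n) ℂ} {N : ℕ}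
    (hN : F.totalDegree < N) {v : Fin n → ℝ} (hv : ∀ j, 0 < v j) (f : MvPolynomial (Fin n) ℂ) :
    eval (dampingZero v) (diffOp F (f * dampingPoly N v)) = 0 := by
  rw [eval_diffOp, symbolPairing]
  refine Finset.sum_eq_zero fun m hm => ?_
  have : coeff (wExp m) (translate (dampingZero v) (f * dampingPoly N v)) = 0 := by
    by_contra hcon
    have h1 := le_of_mem_support_translate_mul_dampingPoly hv f (mem_support_iff.2 hcon) 0
    exact absurd (wExp_le_totalDegree hm 0) (by omega)
  rw [this]
  simp

/-- A real stability preserver extends to complex stable polynomials after damping. The values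
are a priori stable or conjugates of stable polynomials; the second is impossible because damping
forces a zero in the product of the lower half-planes. -/
theorem isStable_or_zero_of_real {F : MvPolynomial (Fin n ⊕ Fin n) ℝ}
    (hF : ∀ f : MvPolynomial (Fin n) ℝ, IsStable f → IsStable (diffOp F f) ∨ diffOp F f = 0)
    {N : ℕ} (hN : F.totalDegree < N) {v : Fin n → ℝ} (hv : ∀ j, 0 < v j)
    {f : MvPolynomial (Fin n) ℂ} (hf : IsStable f) :
    IsStable (diffOp (map (algebraMap ℝ ℂ) F) (f * dampingPoly N v)) ∨
      diffOp (map (algebraMap ℝ ℂ) F) (f * dampingPoly N v) = 0 := by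
  rcases Nat.eq_zero_or_pos n with rfl | hn
  · -- without variables every polynomial is a constant
    rw [or_iff_not_imp_right]
    intro hne
    rw [isStable_iff_eval]
    intro z _ hz
    exact hne (MvPolynomial.funext fun x => by rw [Subsingleton.elim x z, hz, map_zero])
  have : NeZero n := ⟨hn.ne'⟩
  have hlt : ∀ z : Fin n → ℂ, (∀ i, 0 < (z i).im) →
      ‖eval (fun i => (starRingEnd ℂ) (z i)) (f * dampingPoly N v)‖ <
        ‖eval z (f * dampingPoly N v)‖ := by
    intro z hz
    rw [map_mul, map_mul, norm_mul, norm_mul]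
    refine mul_lt_mul' (hf.norm_eval_conj_le hz)
      (norm_eval_conj_dampingPoly_lt (by omega) hv hz) (norm_nonneg _) ?_
    exact norm_pos_iff.2 (isStable_iff_eval.1 hf z hz)
  have hvan := eval_dampingZero_diffOp (F := map (algebraMap ℝ ℂ) F) (N := N)
    (by rwa [totalDegree, support_map_of_injective _ (algebraMap ℝ ℂ).injective]) hv f
  obtain ⟨p, q, hpq⟩ := exists_re_im (f * dampingPoly N v)
  rw [hpq] at hlt hvan ⊢
  have hT : diffOp (map (algebraMap ℝ ℂ) F)
      (map (algebraMap ℝ ℂ) p + Complex.I • map (algebraMap ℝ ℂ) q) =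
      map (algebraMap ℝ ℂ) (diffOp F p) + Complex.I • map (algebraMap ℝ ℂ) (diffOp F q) := by
    rw [map_add, map_smul, diffOp_map, diffOp_map]
  rw [hT] at hvan ⊢
  rcases stable_or_conj_stable_or_zero (P := diffOp F p) (Q := diffOp F q) (fun α β hαβ => by
    rw [← map_smul, ← map_smul, ← map_add]
    exact hF _ (isStable_comb hlt hαβ)) with h | h | h
  · exact Or.inl h
  · exfalso
    refine h (fun i => (starRingEnd ℂ) (dampingZero v i)) (fun i => ?_) ?_
    · have := inv_pos.2 (hv i)
      simpa [dampingZero, Complex.div_im] using hv i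
    · simpa only [Complex.conj_conj] using hvan
  · exact Or.inr h

/-! ### A Hurwitz theorem for polynomials with parameters -/

/-- The value of a polynomial in `s` with parameters in `τ`. -/
def paramEval {τ : Type*} (p : τ → ℂ) (s : ℂ) : Polynomial (MvPolynomial τ ℂ) →ₐ[ℂ] ℂ :=
  (Polynomial.aeval s : Polynomial ℂ →ₐ[ℂ] ℂ).comp
    (Polynomial.mapAlgHom (aeval p : MvPolynomial τ ℂ →ₐ[ℂ] ℂ))

theorem paramEval_apply {τ : Type*} (p : τ → ℂ) (s : ℂ) (Φ : Polynomial (MvPolynomial τ ℂ)) :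
    paramEval p s Φ = (Φ.map (eval p)).eval s := rfl

theorem continuous_paramEval {τ : Type*} (s : ℂ) (Φ : Polynomial (MvPolynomial τ ℂ)) :
    Continuous fun p : τ → ℂ => paramEval p s Φ := by
  have : (fun p : τ → ℂ => paramEval p s Φ) =
      fun p => ∑ i ∈ Finset.range (Φ.natDegree + 1), eval p (Φ.coeff i) * s ^ i := by
    ext p
    rw [paramEval_apply, Polynomial.eval_map, Polynomial.eval₂_eq_sum_range]
  rw [this]
  exact continuous_finsetSum _ fun i _ =>
    (MvPolynomial.continuous_eval (Φ.coeff i)).mul continuous_const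

/-- If polynomials depending continuously on parameters have no zeros in a fixed disc around `0`,
and the limit vanishes at `0`, then the limit vanishes identically, here at `1`: with all roots at
distance at least `ρ` from `0`, the value at `1` is at most a constant times the value at `0`. -/
theorem paramEval_one_eq_zero {τ : Type*} {Φ : Polynomial (MvPolynomial τ ℂ)} {p : ℕ → τ → ℂ}
    {q : τ → ℂ} (hp : Tendsto p atTop (𝓝 q)) {ρ : ℝ} (hρ : 0 < ρ)
    (hne : ∀ k s, ‖s‖ < ρ → paramEval (p k) s Φ ≠ 0) (h0 : paramEval q 0 Φ = 0) :
    paramEval q 1 Φ = 0 := by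
  have hM : 1 ≤ 1 + 1 / ρ := le_add_of_nonneg_right (by positivity)
  have hbound : ∀ k, ‖paramEval (p k) 1 Φ‖ ≤
      (1 + 1 / ρ) ^ Φ.natDegree * ‖paramEval (p k) 0 Φ‖ := by
    intro k
    rw [paramEval_apply, paramEval_apply]
    refine (norm_eval_le_of_roots (b := 0) (M := 1 + 1 / ρ) (fun r hr => ?_)
      (zero_le_one.trans hM)).trans ?_
    · have hr' : ρ ≤ ‖r‖ := by
        by_contra! hlt
        exact hne k r hlt hr
      rw [zero_sub, norm_neg, add_mul, one_mul, one_div, add_comm ‖r‖]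
      refine (norm_sub_le _ _).trans ?_
      rw [norm_one]
      refine add_le_add_left ?_ _
      rw [inv_mul_eq_div]
      exact (one_le_div hρ).2 hr'
    · exact mul_le_mul_of_nonneg_right (pow_le_pow_right₀ hM Polynomial.natDegree_map_le)
        (norm_nonneg _)
  have h1 := ((continuous_paramEval 1 Φ).tendsto q).comp hp
  have h2 := (((continuous_paramEval 0 Φ).tendsto q).comp hp).norm.const_mul
    ((1 + 1 / ρ) ^ Φ.natDegree)
  rw [h0, norm_zero, mul_zero] at h2
  exact tendsto_nhds_unique h1 (squeeze_zero_norm hbound h2)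

/-! ### Scaling the symbol -/

/-- The scaled operator at `z` as a pairing with the increment polynomial `ξ ↦ f(z + ν ξ)`. -/
theorem symbolPairing_rescaled (F : MvPolynomial (Fin n ⊕ Fin n) ℂ) (μ ν : Fin n → ℝ)
    (f : MvPolynomial (Fin n) ℂ) (z : Fin n → ℂ) :
    symbolPairing F (fun j => (μ j : ℂ) * z j)
      (aeval (fun j => C (z j) + C (ν j : ℂ) * X j) f) = eval z (diffOp (scale μ ν F) f) := by
  rw [eval_diffOp, symbolPairing_scale, translate, comp_aeval_apply]
  congr 3
  ext1 j
  simp [algebraMap_eq, add_comm]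

/-- The damped pairing as the original operator at `μ z`: the polynomial
`x ↦ f((1 - ν μ) z + ν x)` takes the value `f(z + ν ξ)` at `x = μ z + ξ`. -/
theorem symbolPairing_damped (F : MvPolynomial (Fin n ⊕ Fin n) ℂ) (μ ν v : Fin n → ℝ) (N : ℕ)
    (f : MvPolynomial (Fin n) ℂ) (z : Fin n → ℂ) :
    symbolPairing F (fun j => (μ j : ℂ) * z j)
      (aeval (fun j => C (z j) + C (ν j : ℂ) * X j) f *
        damping N (fun j => C (v j : ℂ)) (fun j => C ((μ j : ℂ) * z j) + X j)) =
    eval (fun j => (μ j : ℂ) * z j) (diffOp F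
      (aeval (fun j => C (((1 - ν j * μ j : ℝ) : ℂ) * z j) + C (ν j : ℂ) * X j) f *
        dampingPoly N v)) := by
  have h1 : translate (fun j => (μ j : ℂ) * z j)
      (aeval (fun j => C (((1 - ν j * μ j : ℝ) : ℂ) * z j) + C (ν j : ℂ) * X j) f) =
      aeval (fun j => C (z j) + C (ν j : ℂ) * X j) f := by
    rw [comp_aeval_apply]
    refine congrArg (fun g : Fin n → MvPolynomial (Fin n) ℂ => aeval g f) (funext fun j => ?_)
    simp only [map_add, map_mul, translate_C, translate_X, Complex.ofReal_sub, Complex.ofReal_one,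
      Complex.ofReal_mul, map_sub, map_one]
    ring
  have h2 : translate (fun j => (μ j : ℂ) * z j) (dampingPoly N v) =
      damping N (fun j => C (v j : ℂ)) (fun j => C ((μ j : ℂ) * z j) + X j) := by
    rw [dampingPoly, map_damping]
    simp only [translate_C, translate_X, add_comm]
  rw [eval_diffOp, map_mul, h1, h2]

theorem isStable_interpolate {f : MvPolynomial (Fin n) ℂ} (hf : IsStable f) {μ ν : Fin n → ℝ}
    (hμ : ∀ i, μ i ∈ Set.Icc (0 : ℝ) 1) (hν : ∀ i, ν i ∈ Set.Icc (0 : ℝ) 1) {z : Fin n → ℂ}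
    (hz : ∀ i, 0 < (z i).im) :
    IsStable (aeval (fun j => C (((1 - ν j * μ j : ℝ) : ℂ) * z j) + C (ν j : ℂ) * X j) f :
      MvPolynomial (Fin n) ℂ) := by
  intro x hx
  rw [comp_aeval_apply]
  refine hf _ fun i => ?_
  have him : (aeval x (C (((1 - ν i * μ i : ℝ) : ℂ) * z i) + C (ν i : ℂ) * X i :
      MvPolynomial (Fin n) ℂ)).im = (1 - ν i * μ i) * (z i).im + ν i * (x i).im := by
    simp only [map_add, map_mul, aeval_X, aeval_C, Algebra.algebraMap_self, RingHom.id_apply,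
      Complex.add_im, Complex.im_ofReal_mul]
  rw [him]
  have h1 := (hν i).1
  have h2 : ν i * μ i ≤ ν i := mul_le_of_le_one_right h1 (hμ i).2
  rcases (hν i).1.eq_or_lt with h | h
  · rw [← h]
    simpa using hz i
  · have h3 := mul_pos h (hx i)
    have h4 : 0 ≤ (1 - ν i * μ i) * (z i).im :=
      mul_nonneg (by linarith [(hν i).2]) (hz i).le
    linarith

/-- The scaled operator at `z` is the original operator, evaluated at `μ z`, on the stable
polynomial `f((1 - ν μ) z + ν x)` in `x`. Damping makes the values nonzero for all `z` at once, and
a limit of nonvanishing polynomials is nonvanishing or zero. -/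
theorem isStable_or_zero_diffOp_scale {F : MvPolynomial (Fin n ⊕ Fin n) ℂ} (hF : F ≠ 0) {N : ℕ}
    (hN : F.totalDegree ≤ N)
    (h : ∀ v : Fin n → ℝ, (∀ j, 0 < v j) → ∀ f : MvPolynomial (Fin n) ℂ, IsStable f →
      IsStable (diffOp F (f * dampingPoly N v)) ∨ diffOp F (f * dampingPoly N v) = 0)
    {μ ν : Fin n → ℝ} (hμ : ∀ i, μ i ∈ Set.Icc (0 : ℝ) 1) (hν : ∀ i, ν i ∈ Set.Icc (0 : ℝ) 1)
    {f : MvPolynomial (Fin n) ℂ} (hf : IsStable f) :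
    IsStable (diffOp (scale μ ν F) f) ∨ diffOp (scale μ ν F) f = 0 := by
  by_contra! hcon
  obtain ⟨hst, hne⟩ := hcon
  rw [isStable_iff_eval] at hst
  push Not at hst
  obtain ⟨z₀, hz₀, hval₀⟩ := hst
  obtain ⟨z₁, hval₁⟩ : ∃ z₁, eval z₁ (diffOp (scale μ ν F) f) ≠ 0 := by
    by_contra! hcon
    exact hne (MvPolynomial.funext fun x => (hcon x).trans (map_zero _).symm)
  let z : ℂ → Fin n → ℂ := fun s j => z₀ j + s * (z₁ j - z₀ j)
  -- the parameters are `(v, μ')`, and `s` runs along the complex line through `z₀` and `z₁`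
  let Z : Fin n → Polynomial (MvPolynomial (Fin n ⊕ Fin n) ℂ) := fun j =>
    algebraMap ℂ _ (z₀ j) + Polynomial.X * algebraMap ℂ _ (z₁ j - z₀ j)
  let M : Fin n → Polynomial (MvPolynomial (Fin n ⊕ Fin n) ℂ) := fun j =>
    Polynomial.C (X (Sum.inr j))
  let V : Fin n → Polynomial (MvPolynomial (Fin n ⊕ Fin n) ℂ) := fun j =>
    Polynomial.C (X (Sum.inl j))
  let Φ : Polynomial (MvPolynomial (Fin n ⊕ Fin n) ℂ) :=
    symbolPairing F (fun j => M j * Z j)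
      (aeval (fun j => C (Z j) + C (algebraMap ℂ _ (ν j : ℂ)) * X j) f *
        damping N (fun j => C (V j)) (fun j => C (M j * Z j) + X j))
  have hZ : ∀ p s j, paramEval p s (Z j) = z s j := by
    intro p s j
    simp [Z, z, paramEval]
  have hMV : ∀ p s j, paramEval p s (M j) = p (Sum.inr j) ∧ paramEval p s (V j) = p (Sum.inl j) := by
    intro p s j
    simp [M, V, paramEval]
  have hΦ : ∀ (v μ' : Fin n → ℝ) (s : ℂ),
      paramEval (Sum.elim (fun j => (v j : ℂ)) fun j => (μ' j : ℂ)) s Φ =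
        symbolPairing F (fun j => (μ' j : ℂ) * z s j)
          (aeval (fun j => C (z s j) + C (ν j : ℂ) * X j) f *
            damping N (fun j => C (v j : ℂ)) (fun j => C ((μ' j : ℂ) * z s j) + X j)) := by
    intro v μ' s
    simp only [Φ]
    rw [map_symbolPairing, map_mul, map_damping, comp_aeval_apply]
    simp only [map_mul, map_add, mapAlgHom_apply, map_C, map_X, RingHom.coe_coe, hZ, (hMV _ _ _).1,
      (hMV _ _ _).2, Sum.elim_inl, Sum.elim_inr, AlgHom.commutes, Algebra.algebraMap_self,
      RingHom.id_apply]
  -- at the limiting parameters the value is the scaled operator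
  have hlim : ∀ s, paramEval (Sum.elim (fun j => (((0 : Fin n → ℝ) j : ℝ) : ℂ))
      fun j => (μ j : ℂ)) s Φ = eval (z s) (diffOp (scale μ ν F) f) := by
    intro s
    rw [hΦ, ← symbolPairing_rescaled]
    simp [damping]
  have hpos : ∀ k : ℕ, (0 : ℝ) < 1 / ((k : ℝ) + 1) := fun k => Nat.one_div_pos_of_nat
  choose v hv hvlt hinj using fun k : ℕ => exists_small_damping hF hN (hpos k)
  let μ' : ℕ → Fin n → ℝ := fun k j => μ j + (1 - μ j) * (1 / ((k : ℝ) + 1))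
  have hμ'1 : ∀ k j, μ' k j ∈ Set.Icc (0 : ℝ) 1 := by
    intro k j
    have h1 : 1 / ((k : ℝ) + 1) ≤ 1 := by
      rw [div_le_one (by positivity)]
      linarith [(Nat.cast_nonneg k : (0 : ℝ) ≤ k)]
    have h2 := mul_nonneg (sub_nonneg.2 (hμ j).2) (hpos k).le
    have h3 := mul_le_mul_of_nonneg_left h1 (sub_nonneg.2 (hμ j).2)
    exact ⟨add_nonneg (hμ j).1 h2, by simp only [μ']; linarith⟩
  have hμ'0 : ∀ k j, 0 < μ' k j := by
    intro k j
    rcases (hμ j).2.eq_or_lt with h1 | h1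
    · simp [μ', h1]
    · exact add_pos_of_nonneg_of_pos (hμ j).1 (mul_pos (sub_pos.2 h1) (hpos k))
  have htend : Tendsto (fun k => Sum.elim (fun j => (v k j : ℂ)) fun j => (μ' k j : ℂ)) atTop
      (𝓝 (Sum.elim (fun j => (((0 : Fin n → ℝ) j : ℝ) : ℂ)) fun j => (μ j : ℂ))) := by
    rw [tendsto_pi_nhds]
    rintro (j | j)
    · refine (Complex.continuous_ofReal.tendsto _).comp ?_
      exact squeeze_zero (fun k => (hv k j).le) (fun k => (hvlt k j).le)
        tendsto_one_div_add_atTop_nhds_zero_nat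
    · refine (Complex.continuous_ofReal.tendsto _).comp ?_
      have := (tendsto_one_div_add_atTop_nhds_zero_nat (𝕜 := ℝ)).const_mul (1 - μ j)
      simpa [μ'] using this.const_add (μ j)
  obtain ⟨ρ, hρ, hball⟩ : ∃ ρ > 0, ∀ s : ℂ, ‖s‖ < ρ → ∀ j, 0 < (z s j).im := by
    have hopen : ∀ᶠ s in 𝓝 (0 : ℂ), ∀ j, 0 < (z s j).im := by
      rw [eventually_all]
      intro j
      have hc : Continuous fun s => (z s j).im := by fun_prop
      exact hc.continuousAt.eventually (lt_mem_nhds (by simpa [z] using hz₀ j))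
    obtain ⟨ρ, hρ, hsub⟩ := Metric.eventually_nhds_iff.1 hopen
    exact ⟨ρ, hρ, fun s hs => hsub (by simpa using hs)⟩
  have hnv : ∀ k s, ‖s‖ < ρ →
      paramEval (Sum.elim (fun j => (v k j : ℂ)) fun j => (μ' k j : ℂ)) s Φ ≠ 0 := by
    intro k s hs
    rw [hΦ, symbolPairing_damped]
    have hg := isStable_interpolate hf (hμ'1 k) hν (hball s hs)
    refine (h (v k) (hv k) _ hg).resolve_right (hinj k _ hg.ne_zero) _ fun j => ?_
    rw [Complex.im_ofReal_mul]
    exact mul_pos (hμ'0 k j) (hball s hs j)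
  have hfin := paramEval_one_eq_zero htend hρ hnv
    (by rw [hlim]; simpa [z] using hval₀)
  rw [hlim] at hfin
  exact hval₁ (by simpa [z] using hfin)

/-! ### Stability preservers -/

theorem diffOp_ne_zero_complex {F : MvPolynomial (Fin n ⊕ Fin n) ℂ} (hF : F ≠ 0) :
    diffOp F ≠ 0 := by
  obtain ⟨v, -, -, h⟩ := exists_small_damping hF le_rfl one_pos
  intro h0
  exact h 1 one_ne_zero (by rw [h0, LinearMap.zero_apply])

theorem diffOp_ne_zero_real {F : MvPolynomial (Fin n ⊕ Fin n) ℝ} (hF : F ≠ 0) :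
    diffOp F ≠ 0 := by
  intro h0
  have hinj := map_injective (σ := Fin n ⊕ Fin n) _ (algebraMap ℝ ℂ).injective
  refine diffOp_ne_zero_complex (F := map (algebraMap ℝ ℂ) F)
    (fun h => hF (hinj (h.trans (map_zero _).symm))) (LinearMap.ext fun f => ?_)
  obtain ⟨p, q, rfl⟩ := exists_re_im f
  rw [map_add, map_smul, diffOp_map, diffOp_map, h0]
  simp

theorem scale_map (μ ν : Fin n → ℝ) (F : MvPolynomial (Fin n ⊕ Fin n) ℝ) :
    scale μ ν (map (algebraMap ℝ ℂ) F) = map (algebraMap ℝ ℂ) (scale μ ν F) := by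
  ext m
  rw [coeff_map, coeff_scale, coeff_scale, coeff_map]
  simp

theorem exists_eq_zero_of_scale_eq_zero {K : Type*} [Field K] [Algebra ℝ K] {μ ν : Fin n → ℝ}
    {F : MvPolynomial (Fin n ⊕ Fin n) K} (hF : F ≠ 0) (h : scale μ ν F = 0) :
    ∃ i, μ i = 0 ∨ ν i = 0 := by
  by_contra! hcon
  obtain ⟨m, hm⟩ := ne_zero_iff.1 hF
  have h1 := coeff_scale μ ν F m
  rw [h, coeff_zero] at h1
  refine mul_ne_zero (mul_ne_zero ?_ ?_) hm h1.symm
  · exact Finset.prod_ne_zero_iff.2 fun i _ => pow_ne_zero _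
      ((map_ne_zero_iff _ (algebraMap ℝ K).injective).2 (hcon i).1)
  · exact Finset.prod_ne_zero_iff.2 fun i _ => pow_ne_zero _
      ((map_ne_zero_iff _ (algebraMap ℝ K).injective).2 (hcon i).2)

theorem diffOp_zero {K : Type*} [Field K] :
    diffOp (0 : MvPolynomial (Fin n ⊕ Fin n) K) = 0 := by
  simp [diffOp]

theorem exists_symbol_scale_real (F : MvPolynomial (Fin n ⊕ Fin n) ℝ)
    (h : ∃ T ∈ stabilityPreservers ℝ n, IsSymbol F T) {μ ν : Fin n → ℝ}
    (hμ : ∀ i, μ i ∈ Set.Icc (0 : ℝ) 1) (hν : ∀ i, ν i ∈ Set.Icc (0 : ℝ) 1) :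
    (∃ T ∈ stabilityPreservers ℝ n, IsSymbol (scale μ ν F) T) ∨
      (scale μ ν F = 0 ∧ ∃ i, μ i = 0 ∨ ν i = 0) := by
  obtain ⟨T, ⟨-, hT0, hT⟩, rfl⟩ := h
  have hF : F ≠ 0 := by
    rintro rfl
    exact hT0 diffOp_zero
  by_cases hs : scale μ ν F = 0
  · exact Or.inr ⟨hs, exists_eq_zero_of_scale_eq_zero hF hs⟩
  refine Or.inl ⟨_, ⟨⟨_, rfl⟩, diffOp_ne_zero_real hs, fun f hf => ?_⟩, rfl⟩
  have hinj := fun σ => map_injective (σ := σ) _ (algebraMap ℝ ℂ).injective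
  have hdeg : (map (algebraMap ℝ ℂ) F).totalDegree = F.totalDegree := by
    rw [totalDegree, support_map_of_injective _ (algebraMap ℝ ℂ).injective, totalDegree]
  have key := isStable_or_zero_diffOp_scale (F := map (algebraMap ℝ ℂ) F)
    (fun h => hF (hinj _ (h.trans (map_zero _).symm)))
    (N := F.totalDegree + 1) (hdeg.le.trans (Nat.le_succ _))
    (fun v hv f hf => isStable_or_zero_of_real hT (Nat.lt_succ_self _) hv hf) hμ hν
    (isStable_map_iff.2 hf)
  rw [scale_map, diffOp_map, isStable_map_iff] at key
  exact key.imp_right fun h => hinj _ (h.trans (map_zero _).symm)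

theorem exists_symbol_scale_complex (F : MvPolynomial (Fin n ⊕ Fin n) ℂ)
    (h : ∃ T ∈ stabilityPreservers ℂ n, IsSymbol F T) {μ ν : Fin n → ℝ}
    (hμ : ∀ i, μ i ∈ Set.Icc (0 : ℝ) 1) (hν : ∀ i, ν i ∈ Set.Icc (0 : ℝ) 1) :
    (∃ T ∈ stabilityPreservers ℂ n, IsSymbol (scale μ ν F) T) ∨
      (scale μ ν F = 0 ∧ ∃ i, μ i = 0 ∨ ν i = 0) := by
  obtain ⟨T, ⟨-, hT0, hT⟩, rfl⟩ := h
  have hF : F ≠ 0 := by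
    rintro rfl
    exact hT0 diffOp_zero
  by_cases hs : scale μ ν F = 0
  · exact Or.inr ⟨hs, exists_eq_zero_of_scale_eq_zero hF hs⟩
  refine Or.inl ⟨_, ⟨⟨_, rfl⟩, diffOp_ne_zero_complex hs, fun f hf => ?_⟩, rfl⟩
  exact isStable_or_zero_diffOp_scale hF le_rfl
    (fun v hv f hf => hT _ (hf.mul (isStable_dampingPoly _ hv))) hμ hν hf

end WeylStab

end

theorem theorem4p5 (n : ℕ) :
    (∀ F : MvPolynomial (Fin n ⊕ Fin n) ℝ,
      (∃ T ∈ WeylStab.stabilityPreservers ℝ n, WeylStab.IsSymbol F T) →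
      ∀ μ ν : Fin n → ℝ, (∀ i, μ i ∈ Set.Icc (0 : ℝ) 1) → (∀ i, ν i ∈ Set.Icc (0 : ℝ) 1) →
        (∃ T ∈ WeylStab.stabilityPreservers ℝ n, WeylStab.IsSymbol (WeylStab.scale μ ν F) T) ∨
        (WeylStab.scale μ ν F = 0 ∧ ∃ i, μ i = 0 ∨ ν i = 0)) ∧
    (∀ F : MvPolynomial (Fin n ⊕ Fin n) ℂ,
      (∃ T ∈ WeylStab.stabilityPreservers ℂ n, WeylStab.IsSymbol F T) →
      ∀ μ ν : Fin n → ℝ, (∀ i, μ i ∈ Set.Icc (0 : ℝ) 1) → (∀ i, ν i ∈ Set.Icc (0 : ℝ) 1) →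
        (∃ T ∈ WeylStab.stabilityPreservers ℂ n, WeylStab.IsSymbol (WeylStab.scale μ ν F) T) ∨
        (WeylStab.scale μ ν F = 0 ∧ ∃ i, μ i = 0 ∨ ν i = 0)) :=
  ⟨fun F h _ _ hμ hν => WeylStab.exists_symbol_scale_real F h hμ hν,
    fun F h _ _ hμ hν => WeylStab.exists_symbol_scale_complex F h hμ hν⟩
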